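/- Let $\mathcal M=(S,\mathit{Act},\mathbf P,s_0,\mathit{AP},L)$ be a finite Markov decision process: $S$ and $\mathit{Act}$ are finite, $\mathbf P:S\times\mathit{Act}\times S\to[0,1]$ satisfies $\sum_{s'}\mathbf P(s,a,s')\in\{0,1\}$ for all $s,a$, and $\mathit{Act}(s)=\{a:\sum_{s'}\mathbf P(s,a,s')=1\}$ is the set of actions enabled in $s$. Let $\mathrm{Reach}(\mathcal M,s)$ be the set of states reachable from $s$ (including $s$) by any choice of actions, and assume that $\mathit{Act}(s)\neq\emptyset$ for every $s\in\mathrm{Reach}(\mathcal M,s_0)$. Let $\Sigma_s$ be the set of pure memoryless strategies from $s$, that is, of functions $\sigma:\mathrm{Reach}(\mathcal M,s)\to\mathit{Act}$ with $\sigma(t)\in\mathit{Act}(t)$ for all $t$; each of them induces a Markov chain started in $s$, whose law on infinite paths is denoted by $\Pr^{\sigma}_{\mathcal M,s}$. Let $B\subseteq S$, let $\Diamond\Box B$ be the event that from some moment on the path stays in $B$, and let $q=\mathrm P_{\max}[\Diamond\Box B]$. A local optimal strategy for $\langle q,s\rangle$ is a $\sigma\in\Sigma_s$ with $\Pr^{\sigma}_{\mathcal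 M,s}(\Diamond\Box B)=\sup_{\tau\in\Sigma_s}\Pr^{\tau}_{\mathcal M,s}(\Diamond\Box B)$. Then local optimal strategies $\sigma_{\langle q,s\rangle}$ for $\langle q,s\rangle$ can be chosen, for all $s\in\mathrm{Reach}(\mathcal M,s_0)$ at once, such that $$\sigma_{\langle q,s\rangle}=\sigma_{\langle q,s_0\rangle}|_{\mathrm{Reach}(\mathcal M,s)}\qquad\text{for all } s\in\mathrm{Reach}(\mathcal M,s_0);$$ that is, one memoryless strategy that is optimal at $s_0$ is, restricted to $\mathrm{Reach}(\mathcal M,s)$, optimal from every reachable state $s$. Moreover, for every local optimal strategy $\sigma$ for $\langle q,s_0\rangle$ and every state $s$ that is reachable from $s_0$ under $\sigma$, the restriction $\sigma|_{\mathrm{Reach}(\mathcal M,s)}$ is a local optimal strategy for $\langle q,s\rangle$. -/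

import Mathlib

open MeasureTheory ProbabilityTheory

/-- A finite Markov decision process with states `S`, actions `Act` and atomic propositions `AP`.
An action whose transition probabilities sum to `0` in a state is disabled there. -/
structure MDP (S Act AP : Type*) [Fintype S] where
  /-- the transition probability function -/
  P : S → Act → S → ℝ
  P_mem : ∀ s a t, P s a t ∈ Set.Icc (0 : ℝ) 1
  P_sum : ∀ s a, ∑ t, P s a t ∈ ({0, 1} : Set ℝ)
  /-- the initial state -/
  init : S
  /-- the labelling function -/
  label : S → Set AP

namespace MDP

variable {S Act AP : Type*} [Fintype S]

/-- `Act(s)`, the actions that are enabled in the state `s`. -/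
def enabled (M : MDP S Act AP) (s : S) : Set Act := {a | ∑ t, M.P s a t = 1}

/-- `Reach(M, s)`, the states reachable from `s` (including `s`) by any choice of actions. -/
def reach (M : MDP S Act AP) (s : S) : Set S :=
  {t | Relation.ReflTransGen (fun u v => ∃ a, 0 < M.P u a v) s t}

theorem mem_reach_self (M : MDP S Act AP) (s : S) : s ∈ M.reach s := Relation.ReflTransGen.refl

theorem reach_subset (M : MDP S Act AP) {s t : S} (ht : t ∈ M.reach s) :
    M.reach t ⊆ M.reach s := fun _ hu => Relation.ReflTransGen.trans ht hu

/-- A (pure memoryless) strategy from the state `s`: it is defined exactly on `Reach(M, s)`, and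
chooses an enabled action in each of these states. -/
@[ext]
structure Strategy (M : MDP S Act AP) (s : S) where
  act : M.reach s → Act
  act_enabled : ∀ t : M.reach s, act t ∈ M.enabled t

/-- A Markov chain with transition kernel `κ` started in `s`: the law of its infinite paths. -/
noncomputable def pathMeasure [MeasurableSpace S] (κ : Kernel S S) [IsMarkovKernel κ] (s : S) :
    Measure (ℕ → S) :=
  Kernel.traj (X := fun _ => S)
    (fun n => κ.comap (fun x : (i : Finset.Iic n) → S => x ⟨n, Finset.mem_Iic.2 le_rfl⟩)
      (measurable_pi_apply _)) 0 (fun _ => s)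

/-- The event `◇□B`: from some moment on, the path stays in `B`. -/
def persistence (B : Set S) : Set (ℕ → S) := {π | ∃ n, ∀ m ≥ n, π m ∈ B}

namespace Strategy

variable {M : MDP S Act AP} {s : S}

/-- The restriction of a strategy from `s` to `Reach(M, t)`, for a state `t` reachable from `s`. -/
def restrict (σ : M.Strategy s) {t : S} (ht : t ∈ M.reach s) : M.Strategy t where
  act u := σ.act ⟨u, M.reach_subset ht u.2⟩
  act_enabled u := σ.act_enabled ⟨u, M.reach_subset ht u.2⟩

/-- `Reach(M, s, σ)`, the states reachable from `s` under the strategy `σ`. -/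
def reach (σ : M.Strategy s) : Set S :=
  {t | Relation.ReflTransGen (fun u v => ∃ hu : u ∈ M.reach s, 0 < M.P u (σ.act ⟨u, hu⟩) v) s t}

variable [MeasurableSpace S]

open Classical in
/-- One step of the Markov chain that `σ` induces. States outside `Reach(M, s)`, which the chain
never visits when it starts in `s`, are made absorbing. -/
noncomputable def step (σ : M.Strategy s) (t : S) : Measure S :=
  if h : t ∈ M.reach s then ∑ u, ENNReal.ofReal (M.P t (σ.act ⟨t, h⟩) u) • Measure.dirac u
  else Measure.dirac t

instance (σ : M.Strategy s) (t : S) : IsProbabilityMeasure (σ.step t) := by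
  unfold step
  split_ifs with h
  · constructor
    have hs : ∑ u, M.P t (σ.act ⟨t, h⟩) u = 1 := σ.act_enabled ⟨t, h⟩
    simp [← ENNReal.ofReal_sum_of_nonneg fun u _ => (M.P_mem t (σ.act ⟨t, h⟩) u).1, hs]
  · infer_instance

variable [MeasurableSingletonClass S]

/-- The transition kernel of the Markov chain that `σ` induces. -/
noncomputable def kernel (σ : M.Strategy s) : Kernel S S := Kernel.ofFunOfCountable σ.step

instance (σ : M.Strategy s) : IsMarkovKernel σ.kernel :=
  ⟨fun t => inferInstanceAs (IsProbabilityMeasure (σ.step t))⟩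

/-- The probability of the event `φ` for the Markov chain induced by `σ` and started in `s`. -/
noncomputable def prob (σ : M.Strategy s) (φ : Set (ℕ → S)) : ENNReal :=
  pathMeasure σ.kernel s φ

/-- `σ` is a local optimal strategy for the objective `P_max[φ]` at `s`: it attains the supremum
of the probability of `φ` over all strategies from `s`. -/
def IsLocalOptimal (σ : M.Strategy s) (φ : Set (ℕ → S)) : Prop :=
  σ.prob φ = ⨆ τ : M.Strategy s, τ.prob φ

end Strategy

end MDP

/-! `◇□B` is invariant under the shift, so the value of a memoryless strategy, as a function of the
starting state, is harmonic for its chain. There are finitely many strategies from `s₀`, hence one,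
`τ`, whose value vector is maximal in the pointwise order. It is optimal everywhere, by two exchange
arguments based on the maximum principle. If an action violated superharmonicity of the value of
`τ`, switching to it would improve `τ` (`IsUndominated.sum_le`). Superharmonicity alone does not
bound other strategies, since it is blind to constants on closed sets; but if `σ` beat `τ`
somewhere, playing `σ` on the closed set of largest gain and `τ` elsewhere would dominate `τ`
(`IsUndominated.value_le`). Restrictions of `τ` give the first claim. For the second, the value of
an optimal `σ` is harmonic and that of `τ` superharmonic, so equality at a state forces equality at
its successors under `σ`. -/

namespace MDP

/-! ### Path measures of finite Markov chains -/

section Paths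

open Preorder

variable {S : Type*}

theorem shift_preimage_persistence (B : Set S) :
    (fun (π : ℕ → S) n => π (n + 1)) ⁻¹' persistence B = persistence B := by
  ext π
  constructor
  · rintro ⟨n, h⟩
    refine ⟨n + 1, fun m hm => ?_⟩
    obtain ⟨k, rfl⟩ : ∃ k, m = k + 1 := ⟨m - 1, by omega⟩
    exact h k (by omega)
  · rintro ⟨n, h⟩
    exact ⟨n, fun m hm => h _ (by omega)⟩

variable [MeasurableSpace S] [MeasurableSingletonClass S]

/-- The paths whose first `n + 1` states are those of `x`. -/
def cyl (n : ℕ) (x : ℕ → S) : Set (ℕ → S) := {π | ∀ i ≤ n, π i = x i}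

theorem measurableSet_cyl (n : ℕ) (x : ℕ → S) : MeasurableSet (cyl n x) := by
  have : cyl n x = ⋂ i, ⋂ _ : i ≤ n, (fun π : ℕ → S => π i) ⁻¹' {x i} := by
    ext; simp [cyl]
  rw [this]
  exact .iInter fun i => .iInter fun _ => measurable_pi_apply i (measurableSet_singleton _)

theorem partialTraj_succ_singleton (κ : Kernel S S) [IsMarkovKernel κ] (n : ℕ) (x : ℕ → S)
    (y : (i : Finset.Iic n) → S) :
    Kernel.partialTraj (X := fun _ => S)
      (fun n => κ.comap (fun x : (i : Finset.Iic n) → S => x ⟨n, Finset.mem_Iic.2 le_rfl⟩)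
        (measurable_pi_apply _)) n (n + 1) y {frestrictLe (n + 1) x} =
      ({frestrictLe n x} : Set ((i : Finset.Iic n) → S)).indicator
        (fun _ => κ (x n) {x (n + 1)}) y := by
  have hpre : IicProdIoc (X := fun _ => S) n (n + 1) ⁻¹' {frestrictLe (n + 1) x} =
      ({frestrictLe n x} : Set ((i : Finset.Iic n) → S)) ×ˢ
        {(Finset.Ioc n (n + 1)).restrict x} := by
    ext ⟨u, v⟩
    simp only [IicProdIoc_def, Set.mem_preimage, Set.mem_singleton_iff, funext_iff,
      Subtype.forall, Finset.mem_Iic, Set.mem_prod, Finset.mem_Ioc]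
    constructor
    · intro h
      refine ⟨fun a ha => ?_, fun a ha => ?_⟩
      · simpa [ha] using h a (by omega)
      · simpa [not_le.2 ha.1] using h a ha.2
    · rintro ⟨h1, h2⟩ a ha
      by_cases h : a ≤ n
      · simpa [h] using h1 a h
      · simpa [h] using h2 a ⟨by omega, ha⟩
  have hlast : MeasurableEquiv.piSingleton (X := fun _ => S) n ⁻¹'
      {(Finset.Ioc n (n + 1)).restrict x} =
      {x (n + 1)} := by
    ext z
    simp only [MeasurableEquiv.piSingleton, Set.mem_preimage, Set.mem_singleton_iff, funext_iff]
    constructor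
    · intro h
      exact h ⟨n + 1, by simp⟩
    · rintro rfl ⟨a, ha⟩
      obtain rfl : a = n + 1 := by rw [Finset.mem_Ioc] at ha; omega
      rfl
  rw [Kernel.partialTraj_succ_self, Kernel.map_apply _ (measurable_IicProdIoc (X := fun _ => S)),
    Measure.map_apply (measurable_IicProdIoc (X := fun _ => S)) (measurableSet_singleton _), hpre,
    Kernel.prod_apply, Kernel.id_apply, Measure.prod_prod,
    Measure.dirac_apply' _ (measurableSet_singleton _),
    Kernel.map_apply' _ (MeasurableEquiv.measurable _) _ (measurableSet_singleton _), hlast,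
    Kernel.comap_apply]
  by_cases hy : y = frestrictLe n x
  · subst hy
    simp
  · simp [hy]

instance isProbabilityMeasure_pathMeasure (κ : Kernel S S) [IsMarkovKernel κ] (s : S) :
    IsProbabilityMeasure (pathMeasure κ s) := by
  unfold pathMeasure; infer_instance

theorem pathMeasure_cyl (κ : Kernel S S) [IsMarkovKernel κ] (s : S) (n : ℕ) (x : ℕ → S) :
    pathMeasure κ s (cyl n x) =
      ({s} : Set S).indicator 1 (x 0) * ∏ i ∈ Finset.range n, κ (x i) {x (i + 1)} := by
  have hc : ∀ n, cyl n x = frestrictLe (π := fun _ => S) n ⁻¹' {frestrictLe n x} := by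
    intro n
    ext π
    simp [cyl, funext_iff]
  rw [hc, ← Measure.map_apply (measurable_frestrictLe n) (measurableSet_singleton _), pathMeasure,
    Kernel.traj_map_frestrictLe_apply]
  induction n with
  | zero =>
    rw [Kernel.partialTraj_self, Kernel.id_apply,
      Measure.dirac_apply' _ (measurableSet_singleton _)]
    by_cases h : x 0 = s
    · simp [h, Set.indicator, funext_iff]
    · simp [h, Set.indicator, funext_iff, Ne.symm h]
  | succ n ih =>
    rw [Kernel.partialTraj_succ_eq_comp (Nat.zero_le n),
      Kernel.comp_apply' _ _ _ (measurableSet_singleton _), Finset.prod_range_succ, ← mul_assoc,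
      ← ih]
    simp_rw [partialTraj_succ_singleton]
    rw [lintegral_indicator (measurableSet_singleton _), lintegral_const,
      Measure.restrict_apply_univ, mul_comm]

variable [Finite S]

/-- For finite `S` the cylinders are the atoms of the finite-dimensional marginals, and these
determine a finite measure as a projective limit. -/
theorem measure_ext_cyl {μ ν : Measure (ℕ → S)} [IsFiniteMeasure μ] [IsFiniteMeasure ν]
    (h : ∀ n x, μ (cyl n x) = ν (cyl n x)) : μ = ν := by
  have key : ∀ n, μ.map (frestrictLe n) = ν.map (frestrictLe (π := fun _ => S) n) := by
    intro n
    refine Measure.ext_of_singleton fun y => ?_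
    rw [Measure.map_apply (measurable_frestrictLe n) (measurableSet_singleton _),
      Measure.map_apply (measurable_frestrictLe n) (measurableSet_singleton _)]
    have : frestrictLe (π := fun _ => S) n ⁻¹' {y} =
        cyl n fun i => y ⟨min i n, Finset.mem_Iic.2 (min_le_right _ _)⟩ := by
      ext π
      simp only [cyl, Set.mem_preimage, Set.mem_singleton_iff, funext_iff, Subtype.forall,
        Finset.mem_Iic, Set.mem_ofPred_eq]
      refine forall₂_congr fun i hi => ?_
      simp [hi]
    rw [this, h]
  have hν : IsProjectiveLimit ν fun I : Finset ℕ => ν.map I.restrict := fun _ => rfl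
  refine IsProjectiveLimit.unique ?_ hν
  rw [isProjectiveLimit_nat_iff]
  · exact key
  · intro I J hJI
    rw [Measure.map_map (Finset.measurable_restrict₂ hJI) (Finset.measurable_restrict I)]
    rfl

/-- Kernels that agree on a closed set of states have the same paths there. -/
theorem pathMeasure_congr {κ κ' : Kernel S S} [IsMarkovKernel κ] [IsMarkovKernel κ'] {A : Set S}
    (h : ∀ u ∈ A, κ u = κ' u) (hA : ∀ u ∈ A, ∀ v ∉ A, κ u {v} = 0) {s : S} (hs : s ∈ A) :
    pathMeasure κ s = pathMeasure κ' s := by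
  refine measure_ext_cyl fun n x => ?_
  rw [pathMeasure_cyl, pathMeasure_cyl]
  by_cases hx : x 0 = s
  · congr 1
    -- A path that has left `A` already has probability zero, so the kernels are compared only
    -- inside `A`.
    have key : ∀ n, ∏ i ∈ Finset.range n, κ (x i) {x (i + 1)} =
        ∏ i ∈ Finset.range n, κ' (x i) {x (i + 1)} ∧
        (x n ∈ A ∨ ∏ i ∈ Finset.range n, κ (x i) {x (i + 1)} = 0) := by
      intro n
      induction n with
      | zero => simp [hx, hs]
      | succ n ih =>
        rw [Finset.prod_range_succ, Finset.prod_range_succ, ← ih.1]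
        rcases ih.2 with hn | hn
        · refine ⟨by rw [h _ hn], ?_⟩
          by_cases hn' : x (n + 1) ∈ A
          · exact .inl hn'
          · exact .inr (by rw [hA _ hn _ hn', mul_zero])
        · simp [hn]
    exact (key n).1
  · simp [hx]

/-- The Markov property after one step. -/
theorem pathMeasure_map_shift {S : Type*} [Fintype S] [MeasurableSpace S]
    [MeasurableSingletonClass S] (κ : Kernel S S) [IsMarkovKernel κ] (s : S) :
    (pathMeasure κ s).map (fun π n => π (n + 1)) = ∑ u, κ s {u} • pathMeasure κ u := by
  have hm : Measurable fun (π : ℕ → S) n => π (n + 1) := by fun_prop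
  have : IsFiniteMeasure (∑ u, κ s {u} • pathMeasure κ u) := ⟨by
    simp [Measure.finsetSum_apply]⟩
  have : IsProbabilityMeasure ((pathMeasure κ s).map (fun π n => π (n + 1))) :=
    Measure.isProbabilityMeasure_map hm.aemeasurable
  refine measure_ext_cyl fun n x => ?_
  rw [Measure.map_apply hm (measurableSet_cyl n x), Measure.finsetSum_apply]
  have hpre : (fun (π : ℕ → S) n => π (n + 1)) ⁻¹' cyl n x =
      ⋃ u ∈ (Finset.univ : Finset S), cyl (n + 1) (fun i => Nat.casesOn i u x) := by
    ext π
    simp only [cyl, Set.mem_preimage, Set.mem_ofPred_eq, Finset.mem_univ, Set.iUnion_true,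
      Set.mem_iUnion]
    constructor
    · intro h
      refine ⟨π 0, fun i hi => ?_⟩
      cases i with
      | zero => rfl
      | succ i => exact h i (by omega)
    · rintro ⟨u, h⟩ i hi
      exact h (i + 1) (by omega)
  rw [hpre, measure_biUnion_finset _ fun u _ => measurableSet_cyl _ _]
  · simp only [pathMeasure_cyl, Measure.smul_apply, smul_eq_mul, Finset.prod_range_succ']
    -- The prepended state must be `s`, and the chain restarted after one step must start in `x 0`.
    rw [Finset.sum_eq_single s, Finset.sum_eq_single (x 0)]
    · simp [mul_comm]
    · intro u _ hu
      simp [Ne.symm hu]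
    · simp
    · intro u _ hu
      simp [hu]
    · simp
  · intro u _ v _ huv
    refine Set.disjoint_left.2 fun π hu hv => huv ?_
    exact (hu 0 (Nat.zero_le _)).symm.trans (hv 0 (Nat.zero_le _))

theorem measurableSet_persistence (B : Set S) : MeasurableSet (persistence B) := by
  have : persistence B = ⋃ n, ⋂ m, ⋂ _ : m ≥ n, (fun π : ℕ → S => π m) ⁻¹' B := by
    ext; simp [persistence]
  rw [this]
  exact .iUnion fun n => .iInter fun m => .iInter fun _ =>
    measurable_pi_apply m B.toFinite.measurableSet

end Paths

end MDP

/-! ### Maximum principle and modification of strategies -/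

namespace MDP

variable {S Act AP : Type*} [Fintype S]

theorem eq_of_le_weighted_sum {p f : S → ℝ} {m : ℝ} (hp : ∀ u, 0 ≤ p u) (hp1 : ∑ u, p u = 1)
    (hf : ∀ u, 0 < p u → f u ≤ m) (h : m ≤ ∑ u, p u * f u) {u : S} (hu : 0 < p u) : f u = m := by
  have hle : ∀ v ∈ Finset.univ, p v * f v ≤ p v * m := fun v _ => by
    rcases (hp v).eq_or_lt with h0 | h0
    · simp [← h0]
    · exact mul_le_mul_of_nonneg_left (hf v h0) (hp v)
  have hsum : ∑ v, p v * f v = ∑ v, p v * m :=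
    le_antisymm (Finset.sum_le_sum hle) (by rwa [← Finset.sum_mul, hp1, one_mul])
  exact mul_left_cancel₀ hu.ne' ((Finset.sum_eq_sum_iff_of_le hle).1 hsum u (Finset.mem_univ _))

namespace Strategy

variable {M : MDP S Act AP} {s s' : S}

/-- The chain induced by `σ` cannot leave `A`. -/
def IsClosed (σ : M.Strategy s) (A : Set S) : Prop :=
  ∀ u (hu : u ∈ M.reach s), u ∈ A → ∀ v, 0 < M.P u (σ.act ⟨u, hu⟩) v → v ∈ A

theorem isClosed_reach (σ : M.Strategy s) : σ.IsClosed (M.reach s) :=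
  fun _ hu _ _ hv => Relation.ReflTransGen.tail hu ⟨_, hv⟩

/-- The maximum principle: a function that is subharmonic for the chain of `σ` attains its maximum
on a closed set. -/
theorem exists_isClosed_argmax (σ : M.Strategy s) (f : S → ℝ)
    (hf : ∀ t (ht : t ∈ M.reach s), f t ≤ ∑ u, M.P t (σ.act ⟨t, ht⟩) u * f u) :
    ∃ t₀ ∈ M.reach s, (∀ t ∈ M.reach s, f t ≤ f t₀) ∧
      σ.IsClosed {t | t ∈ M.reach s ∧ f t = f t₀} := by
  obtain ⟨t₀, ht₀, hmax⟩ := (M.reach s).toFinite.exists_maximalFor f _ ⟨s, M.mem_reach_self s⟩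
  have hle : ∀ t ∈ M.reach s, f t ≤ f t₀ := fun t ht =>
    (le_total (f t) (f t₀)).elim id (hmax ht)
  refine ⟨t₀, ht₀, hle, fun u hu hA v hv => ?_⟩
  have hr : ∀ w, 0 < M.P u (σ.act ⟨u, hu⟩) w → w ∈ M.reach s := σ.isClosed_reach u hu hu
  exact ⟨hr v hv, eq_of_le_weighted_sum (fun w => (M.P_mem _ _ w).1) (σ.act_enabled ⟨u, hu⟩)
    (fun w hw => hle w (hr w hw)) (hA.2 ▸ hf u hu) hv⟩

open Classical in
/-- `σ` inside `A` and `τ` elsewhere, where `σ` need not be defined on all of `Reach(M, s')`. -/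
noncomputable def patch (σ : M.Strategy s) (τ : M.Strategy s') (A : Set S) (hA : A ⊆ M.reach s) :
    M.Strategy s' where
  act u := if h : (u : S) ∈ A then σ.act ⟨u, hA h⟩ else τ.act u
  act_enabled u := by
    split_ifs with h
    · exact σ.act_enabled ⟨u, hA h⟩
    · exact τ.act_enabled u

theorem patch_act_of_mem (σ : M.Strategy s) (τ : M.Strategy s') {A : Set S} (hA : A ⊆ M.reach s)
    {u : S} (hu : u ∈ A) (hu' : u ∈ M.reach s') :
    (σ.patch τ A hA).act ⟨u, hu'⟩ = σ.act ⟨u, hA hu⟩ := by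
  simp [patch, hu]

theorem patch_act_of_notMem (σ : M.Strategy s) (τ : M.Strategy s') {A : Set S}
    (hA : A ⊆ M.reach s) {u : S} (hu : u ∉ A) (hu' : u ∈ M.reach s') :
    (σ.patch τ A hA).act ⟨u, hu'⟩ = τ.act ⟨u, hu'⟩ := by
  simp [patch, hu]

open Classical in
/-- The strategy `σ` with its action in `t` replaced by `a`. -/
noncomputable def update (σ : M.Strategy s) (t : M.reach s) (a : Act) (ha : a ∈ M.enabled t) :
    M.Strategy s where
  act := Function.update σ.act t a
  act_enabled u := by
    by_cases h : u = t
    · subst h; simpa using ha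
    · simpa [h] using σ.act_enabled u

instance finite [Finite Act] : Finite (M.Strategy s) :=
  Finite.of_injective Strategy.act fun _ _ h => Strategy.ext h

/-! ### Values as harmonic functions -/

variable [MeasurableSpace S] [MeasurableSingletonClass S]

theorem kernel_apply (σ : M.Strategy s) {t : S} (ht : t ∈ M.reach s) :
    σ.kernel t = ∑ u, ENNReal.ofReal (M.P t (σ.act ⟨t, ht⟩) u) • Measure.dirac u := by
  change σ.step t = _
  rw [step, dif_pos ht]

theorem kernel_singleton (σ : M.Strategy s) {t : S} (ht : t ∈ M.reach s) (u : S) :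
    σ.kernel t {u} = ENNReal.ofReal (M.P t (σ.act ⟨t, ht⟩) u) := by
  classical
  rw [σ.kernel_apply ht, Measure.finsetSum_apply, Finset.sum_eq_single u]
  · simp
  · intro v _ hv
    simp [hv]
  · simp

theorem pathMeasure_eq_of_isClosed (σ : M.Strategy s) (τ : M.Strategy s') {A : Set S}
    (hσ : A ⊆ M.reach s) (hτ : A ⊆ M.reach s')
    (hact : ∀ u (hu : u ∈ A), σ.act ⟨u, hσ hu⟩ = τ.act ⟨u, hτ hu⟩) (hA : σ.IsClosed A) {t : S}
    (ht : t ∈ A) : pathMeasure σ.kernel t = pathMeasure τ.kernel t := by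
  refine pathMeasure_congr (A := A) (fun u hu => ?_) (fun u hu v hv => ?_) ht
  · rw [σ.kernel_apply (hσ hu), τ.kernel_apply (hτ hu), hact u hu]
  · rw [σ.kernel_singleton (hσ hu), ENNReal.ofReal_eq_zero]
    exact not_lt.1 fun h => hv (hA u (hσ hu) hu v h)

/-- The probability of `φ` in the chain induced by `σ`, as a function of the starting state. -/
noncomputable def value (σ : M.Strategy s) (φ : Set (ℕ → S)) (t : S) : ℝ :=
  (pathMeasure σ.kernel t).real φ

theorem ofReal_value (σ : M.Strategy s) (φ : Set (ℕ → S)) (t : S) :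
    ENNReal.ofReal (σ.value φ t) = pathMeasure σ.kernel t φ :=
  ENNReal.ofReal_toReal (measure_ne_top _ _)

theorem value_nonneg (σ : M.Strategy s) (φ : Set (ℕ → S)) (t : S) : 0 ≤ σ.value φ t :=
  measureReal_nonneg

variable {φ : Set (ℕ → S)}

theorem value_eq_of_isClosed (σ : M.Strategy s) (τ : M.Strategy s') {A : Set S}
    (hσ : A ⊆ M.reach s) (hτ : A ⊆ M.reach s')
    (hact : ∀ u (hu : u ∈ A), σ.act ⟨u, hσ hu⟩ = τ.act ⟨u, hτ hu⟩) (hA : σ.IsClosed A) {t : S}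
    (ht : t ∈ A) : σ.value φ t = τ.value φ t := by
  rw [value, value, σ.pathMeasure_eq_of_isClosed τ hσ hτ hact hA ht]

/-- The value is harmonic if `φ` does not depend on the first state of a path. -/
theorem value_eq_sum (σ : M.Strategy s) (hφ : MeasurableSet φ)
    (hsh : (fun (π : ℕ → S) n => π (n + 1)) ⁻¹' φ = φ) {t : S} (ht : t ∈ M.reach s) :
    σ.value φ t = ∑ u, M.P t (σ.act ⟨t, ht⟩) u * σ.value φ u := by
  have hm : Measurable fun (π : ℕ → S) n => π (n + 1) := by fun_prop
  have h : pathMeasure σ.kernel t φ = ∑ u, σ.kernel t {u} * pathMeasure σ.kernel u φ := by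
    conv_lhs => rw [← hsh]
    rw [← Measure.map_apply hm hφ, pathMeasure_map_shift, Measure.finsetSum_apply]
    rfl
  rw [value, measureReal_def, h, ENNReal.toReal_sum]
  · refine Finset.sum_congr rfl fun u _ => ?_
    rw [ENNReal.toReal_mul, σ.kernel_singleton ht, ENNReal.toReal_ofReal (M.P_mem _ _ _).1]
    rfl
  · exact fun u _ => ENNReal.mul_ne_top (measure_ne_top _ _) (measure_ne_top _ _)

/-! ### Undominated strategies are optimal -/

/-- No strategy is better than `τ` in some state without being worse in another one. -/
def IsUndominated (τ : M.Strategy s) (φ : Set (ℕ → S)) : Prop :=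
  ∀ ρ : M.Strategy s, (∀ t ∈ M.reach s, τ.value φ t ≤ ρ.value φ t) →
    ∀ t ∈ M.reach s, ρ.value φ t ≤ τ.value φ t

theorem exists_isUndominated [Finite Act] [Nonempty (M.Strategy s)] (φ : Set (ℕ → S)) :
    ∃ τ : M.Strategy s, τ.IsUndominated φ := by
  obtain ⟨τ, -, hτ⟩ := (Set.univ : Set (M.Strategy s)).toFinite.exists_maximalFor
    (fun (τ : M.Strategy s) (t : M.reach s) => τ.value φ t) _ Set.univ_nonempty
  exact ⟨τ, fun ρ h t ht => hτ (Set.mem_univ ρ) (fun u => h u u.2) ⟨t, ht⟩⟩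

/-- The value of an undominated strategy is superharmonic: otherwise switching one action improves
the strategy. -/
theorem IsUndominated.sum_le {τ : M.Strategy s} (hτ : τ.IsUndominated φ) (hφ : MeasurableSet φ)
    (hsh : (fun (π : ℕ → S) n => π (n + 1)) ⁻¹' φ = φ) {t : S} (ht : t ∈ M.reach s) {a : Act}
    (ha : a ∈ M.enabled t) : ∑ u, M.P t a u * τ.value φ u ≤ τ.value φ t := by
  by_contra! hlt
  set ρ := τ.update ⟨t, ht⟩ a ha with hρ
  have hact : ρ.act ⟨t, ht⟩ = a := by simp [hρ, update]
  have hact' : ∀ u (hu : u ∈ M.reach s), u ≠ t → τ.act ⟨u, hu⟩ = ρ.act ⟨u, hu⟩ := fun u hu h => by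
    simp [hρ, update, h]
  have hρt := ρ.value_eq_sum hφ hsh ht
  rw [hact] at hρt
  obtain ⟨t₀, ht₀, hle, hcl⟩ := ρ.exists_isClosed_argmax
    (fun u => τ.value φ u - ρ.value φ u) fun u hu => by
      simp only [mul_sub, Finset.sum_sub_distrib]
      rw [← ρ.value_eq_sum hφ hsh hu]
      refine sub_le_sub_right ?_ _
      by_cases h : u = t
      · subst h; rw [hact]; exact hlt.le
      · rw [← hact' u hu h]; exact (τ.value_eq_sum hφ hsh hu).le
  -- At `t` the difference lies strictly below its average over the successors, so it is not maximal
  -- there.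
  have hnot : t ∉ {u | u ∈ M.reach s ∧
      τ.value φ u - ρ.value φ u = τ.value φ t₀ - ρ.value φ t₀} := fun hmem => by
    have hsum : ∑ u, M.P t a u * (τ.value φ u - ρ.value φ u) ≤
        ∑ u, M.P t a u * (τ.value φ t₀ - ρ.value φ t₀) :=
      Finset.sum_le_sum fun u _ => by
        rcases (M.P_mem t a u).1.eq_or_lt with h0 | h0
        · simp [← h0]
        · exact mul_le_mul_of_nonneg_left (hle u (ht.tail ⟨a, h0⟩)) h0.le
    rw [← Finset.sum_mul, show ∑ u, M.P t a u = 1 from ha, one_mul, ← hmem.2] at hsum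
    simp only [mul_sub, Finset.sum_sub_distrib] at hsum
    linarith
  -- From `t₀` the chain of `ρ` never meets `t`, the only state where `ρ` and `τ` may differ. So the
  -- maximal difference is zero.
  have h0 : ρ.value φ t₀ = τ.value φ t₀ :=
    ρ.value_eq_of_isClosed τ (fun _ h => h.1) (fun _ h => h.1)
      (fun u hu => (hact' u hu.1 fun h => hnot (h ▸ hu)).symm) hcl ⟨ht₀, rfl⟩
  have hge : ∀ u ∈ M.reach s, τ.value φ u ≤ ρ.value φ u := fun u hu => by
    have := hle u hu
    linarith
  have hsum : ∑ u, M.P t a u * τ.value φ u ≤ ∑ u, M.P t a u * ρ.value φ u :=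
    Finset.sum_le_sum fun u _ => by
      rcases (M.P_mem t a u).1.eq_or_lt with h0 | h0
      · simp [← h0]
      · exact mul_le_mul_of_nonneg_left (hge u (ht.tail ⟨a, h0⟩)) h0.le
  have := hτ ρ hge t ht
  linarith

/-- An undominated strategy is optimal in all states. -/
theorem IsUndominated.value_le {τ : M.Strategy s} (hτ : τ.IsUndominated φ) (hφ : MeasurableSet φ)
    (hsh : (fun (π : ℕ → S) n => π (n + 1)) ⁻¹' φ = φ) (σ : M.Strategy s) {t : S}
    (ht : t ∈ M.reach s) : σ.value φ t ≤ τ.value φ t := by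
  obtain ⟨t₀, ht₀, hle, hcl⟩ := σ.exists_isClosed_argmax
    (fun u => σ.value φ u - τ.value φ u) fun u hu => by
      simp only [mul_sub, Finset.sum_sub_distrib]
      rw [← σ.value_eq_sum hφ hsh hu]
      exact sub_le_sub_left (hτ.sum_le hφ hsh hu (σ.act_enabled ⟨u, hu⟩)) _
  set A := {u | u ∈ M.reach s ∧ σ.value φ u - τ.value φ u = σ.value φ t₀ - τ.value φ t₀} with hA
  by_contra! hlt
  have hm : 0 < σ.value φ t₀ - τ.value φ t₀ := (sub_pos.2 hlt).trans_le (hle t ht)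
  have hAs : A ⊆ M.reach s := fun _ h => h.1
  set ρ := σ.patch τ A hAs with hρ
  have hρA : ∀ u ∈ A, ρ.value φ u = σ.value φ u := fun u hu =>
    (σ.value_eq_of_isClosed ρ hAs hAs
      (fun v hv => (σ.patch_act_of_mem τ hAs hv (hAs hv)).symm) hcl hu).symm
  obtain ⟨t₁, ht₁, hle₁, hcl₁⟩ := ρ.exists_isClosed_argmax
    (fun u => τ.value φ u - ρ.value φ u) fun u hu => by
      by_cases h : u ∈ A
      · rw [hρA u h]
        -- On the closed set `A` the difference is constant, hence equal to its average.
        have hc : ∀ v, M.P u (ρ.act ⟨u, hu⟩) v * (τ.value φ v - ρ.value φ v) =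
            M.P u (ρ.act ⟨u, hu⟩) v * (τ.value φ t₀ - σ.value φ t₀) := fun v => by
          rw [σ.patch_act_of_mem τ hAs h hu]
          rcases (M.P_mem u (σ.act ⟨u, hu⟩) v).1.eq_or_lt with h0 | h0
          · simp [← h0]
          · have hv := hcl u hu h v h0
            rw [hρA v hv]
            congr 1
            linarith [hv.2]
        simp only [hc]
        rw [← Finset.sum_mul, show ∑ v, M.P u (ρ.act ⟨u, hu⟩) v = 1 from ρ.act_enabled ⟨u, hu⟩]
        linarith [h.2]
      · simp only [mul_sub, Finset.sum_sub_distrib]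
        rw [← ρ.value_eq_sum hφ hsh hu, σ.patch_act_of_notMem τ hAs h hu,
          ← τ.value_eq_sum hφ hsh hu]
  -- A positive maximum is not attained on `A`, where the difference is negative. Off `A` both
  -- strategies act alike, so on the closed argmax set their values would coincide.
  have h1 : τ.value φ t₁ ≤ ρ.value φ t₁ := by
    by_contra! h1
    refine h1.ne (ρ.value_eq_of_isClosed τ (fun _ h => h.1) (fun _ h => h.1) (fun u hu => ?_)
      hcl₁ ⟨ht₁, rfl⟩)
    refine σ.patch_act_of_notMem τ hAs (fun h => ?_) hu.1
    have h2 := hu.2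
    rw [hρA u h] at h2
    linarith [h.2]
  have hge : ∀ u ∈ M.reach s, τ.value φ u ≤ ρ.value φ u := fun u hu => by
    have := hle₁ u hu
    linarith
  have := hτ ρ hge t₀ ht₀
  rw [hρA t₀ ⟨ht₀, rfl⟩] at this
  linarith

/-! ### Comparing strategies with different starting states -/

theorem prob_restrict (σ : M.Strategy s) {t : S} (ht : t ∈ M.reach s) (φ : Set (ℕ → S)) :
    (σ.restrict ht).prob φ = ENNReal.ofReal (σ.value φ t) := by
  rw [ofReal_value, prob, (σ.restrict ht).pathMeasure_eq_of_isClosed σ subset_rfl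
    (M.reach_subset ht) (fun _ _ => rfl) (σ.restrict ht).isClosed_reach (M.mem_reach_self t)]

theorem exists_prob_eq_value [Nonempty (M.Strategy s)] {t : S} (ht : t ∈ M.reach s)
    (τ : M.Strategy t) (φ : Set (ℕ → S)) :
    ∃ σ : M.Strategy s, τ.prob φ = ENNReal.ofReal (σ.value φ t) := by
  obtain ⟨σ⟩ := ‹Nonempty (M.Strategy s)›
  refine ⟨τ.patch σ (M.reach t) subset_rfl, ?_⟩
  rw [ofReal_value, prob, τ.pathMeasure_eq_of_isClosed _ subset_rfl (M.reach_subset ht)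
    (fun u hu => (τ.patch_act_of_mem σ subset_rfl hu _).symm) τ.isClosed_reach
    (M.mem_reach_self t)]

/-- Strategies from `t` extend to strategies from `s` with the same value at `t`, so the supremum at
`t` is attained by the restriction of `τ`. -/
theorem isLocalOptimal_restrict_iff {τ : M.Strategy s}
    (hτ : ∀ (σ : M.Strategy s), ∀ t ∈ M.reach s, σ.value φ t ≤ τ.value φ t)
    (σ : M.Strategy s) {t : S} (ht : t ∈ M.reach s) :
    (σ.restrict ht).IsLocalOptimal φ ↔ σ.value φ t = τ.value φ t := by
  have : Nonempty (M.Strategy s) := ⟨τ⟩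
  have hsup : ⨆ ρ : M.Strategy t, ρ.prob φ = ENNReal.ofReal (τ.value φ t) := by
    refine le_antisymm (iSup_le fun ρ => ?_) ?_
    · obtain ⟨ρ', h⟩ := exists_prob_eq_value ht ρ φ
      rw [h]
      exact ENNReal.ofReal_le_ofReal (hτ ρ' t ht)
    · rw [← τ.prob_restrict ht φ]
      exact le_iSup (fun ρ : M.Strategy t => ρ.prob φ) _
  rw [IsLocalOptimal, hsup, prob_restrict,
    ENNReal.ofReal_eq_ofReal_iff (σ.value_nonneg φ t) (τ.value_nonneg φ t)]

/-- Optimality is passed on along the chain of an optimal strategy. -/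
theorem value_eq_of_mem_reach {τ : M.Strategy s} (hτ : τ.IsUndominated φ) (hφ : MeasurableSet φ)
    (hsh : (fun (π : ℕ → S) n => π (n + 1)) ⁻¹' φ = φ) {σ : M.Strategy s}
    (hσ : σ.value φ s = τ.value φ s) {t : S} (ht : t ∈ σ.reach) :
    σ.value φ t = τ.value φ t := by
  induction ht with
  | refl => exact hσ
  | tail _ hstep ih =>
    obtain ⟨hu, hv⟩ := hstep
    refine sub_eq_zero.1 (eq_of_le_weighted_sum (f := fun w => σ.value φ w - τ.value φ w)
      (fun w => (M.P_mem _ _ w).1) (σ.act_enabled ⟨_, hu⟩)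
      (fun w hw => sub_nonpos.2 (hτ.value_le hφ hsh σ (σ.isClosed_reach _ hu hu w hw))) ?_ hv)
    simp only [mul_sub, Finset.sum_sub_distrib]
    rw [← σ.value_eq_sum hφ hsh hu, ih, sub_nonneg]
    exact hτ.sum_le hφ hsh hu (σ.act_enabled ⟨_, hu⟩)

end Strategy

end MDP

theorem lemma1 {S Act AP : Type*} [Fintype S] [Finite Act]
    [MeasurableSpace S] [MeasurableSingletonClass S]
    (M : MDP S Act AP) (hM : ∀ s ∈ M.reach M.init, (M.enabled s).Nonempty) (B : Set S) :
    (∃ σ : (s : S) → s ∈ M.reach M.init → M.Strategy s,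
      (∀ s hs, (σ s hs).IsLocalOptimal (MDP.persistence B)) ∧
      ∀ s hs, σ s hs = (σ M.init (M.mem_reach_self M.init)).restrict hs) ∧
    ∀ σ₀ : M.Strategy M.init, σ₀.IsLocalOptimal (MDP.persistence B) →
      ∀ s (hs : s ∈ M.reach M.init), s ∈ σ₀.reach →
        (σ₀.restrict hs).IsLocalOptimal (MDP.persistence B) := by
  have hφ := MDP.measurableSet_persistence B
  have hsh := MDP.shift_preimage_persistence B
  have : Nonempty (M.Strategy M.init) :=
    ⟨⟨fun t => (hM t t.2).choose, fun t => (hM t t.2).choose_spec⟩⟩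
  obtain ⟨τ, hτ⟩ := MDP.Strategy.exists_isUndominated (M := M) (s := M.init) (MDP.persistence B)
  have hiff := MDP.Strategy.isLocalOptimal_restrict_iff
    fun σ t ht => hτ.value_le hφ hsh σ (t := t) ht
  refine ⟨⟨fun s hs => τ.restrict hs, fun s hs => (hiff τ hs).2 rfl, fun s hs => rfl⟩, ?_⟩
  intro σ₀ h₀ s hs hreach
  -- Restricting `σ₀` to its own starting state gives `σ₀` definitionally.
  have h₁ := (hiff σ₀ (M.mem_reach_self M.init)).1 h₀
  exact (hiff σ₀ hs).2 (MDP.Strategy.value_eq_of_mem_reach hτ hφ hsh h₁ hreach)
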